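/- For $n \ge 32$ let $f_7 \colon \{0,1\}^n \to \{0,1,\perp\}$ be the partial Boolean function with $f_7(x) = 0$ if the Hamming weight $|x|$ is at most $7$, $f_7(x) = 1$ if $|x| = n$, and $f_7(x) = \perp$ (undefined) if $8 \le |x| \le n-1$. Let $F_7(x,y) = f_7(x \oplus y)$ for $x, y \in \{0,1\}^n$, where $\oplus$ is bitwise XOR. For a partial function $F \colon \{0,1\}^n \times \{0,1\}^n \to \{0,1,\perp\}$, let $\mathrm{D_{cc}^{\rightarrow}}(F)$ (the deterministic one-way communication complexity) be the smallest $t$ for which there are total functions $h \colon \{0,1\}^n \to \{0,1\}^t$ and $\varphi \colon \{0,1\}^t \times \{0,1\}^n \to \{0,1\}$ with $\varphi(h(x), y) = F(x,y)$ whenever $F(x,y) \ne \perp$. For a partial function $f \colon \{0,1\}^n \to \{0,1,\perp\}$, let $\mathrm{NADT^{\oplus}}(f)$ (the non-adaptive parity decision tree complexity) be the smallest $p$ for which there are $s_1, \dots, s_p \in \{0,1\}^n$ and a total function $l \colon \{0,1\}^p \to \{0,1\}$ with $l(\langle s_1, x\rangle, \dots, \langle s_p, x\rangle) = f(x)$ whenever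 $f(x) \ne \perp$, where $\langle s, x\rangle = \bigoplus_i s_i \wedge x_i$. Theorem. For every $n \ge 32$, $$\mathrm{D_{cc}^{\rightarrow}}(F_7) \le 7 \quad\text{and}\quad \mathrm{NADT^{\oplus}}(f_7) = 8.$$ -/

import Mathlib

namespace XorComm

/-- The Boolean cube `{0,1}^n`, viewed as the vector space `𝔽₂ⁿ`; addition is bitwise XOR. -/
abbrev Cube (n : ℕ) : Type := Fin n → ZMod 2

/-- A partial Boolean function `{0,1}^n → {0,1,⊥}`; the value `none` is `⊥` (undefined). -/
abbrev PartialBool (n : ℕ) : Type := Cube n → Option (ZMod 2)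

/-- The XOR function `F(x, y) = f(x ⊕ y)` of a partial Boolean function `f`. -/
def xorFun {n : ℕ} (f : PartialBool n) : Cube n → Cube n → Option (ZMod 2) :=
  fun x y => f (x + y)

/-- Alice's message map `h` and Bob's output map `φ` form a `t`-bit one-way protocol for the
partial two-party function `F`: the output is correct wherever `F` is defined. -/
def OneWayComputes {n t : ℕ} (h : Cube n → Cube t) (φ : Cube t → Cube n → ZMod 2)
    (F : Cube n → Cube n → Option (ZMod 2)) : Prop :=
  ∀ x y : Cube n, ∀ b : ZMod 2, F x y = some b → φ (h x) y = b

/-- One-way deterministic communication complexity: the least `t` such that a `t`-bit one-way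
protocol exists (one always does, see `exists_oneWay`). -/
noncomputable def oneWayCC {n : ℕ} (F : Cube n → Cube n → Option (ZMod 2)) : ℕ :=
  sInf {t : ℕ | ∃ (h : Cube n → Cube t) (φ : Cube t → Cube n → ZMod 2), OneWayComputes h φ F}

/-- The queries `s₁, …, s_p` and the output map `l` form a non-adaptive parity decision tree
for `f`: on input `x` it outputs `l(⟨s₁, x⟩, …, ⟨s_p, x⟩)`, with inner products over `𝔽₂`. -/
def ParityComputes {n p : ℕ} (s : Fin p → Cube n) (l : Cube p → ZMod 2)
    (f : PartialBool n) : Prop :=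
  ∀ x : Cube n, ∀ b : ZMod 2, f x = some b → l (fun i => s i ⬝ᵥ x) = b

/-- Non-adaptive parity decision tree complexity: the least number of queries of a protocol
for `f` (one always exists, see `exists_parity`). -/
noncomputable def nadt {n : ℕ} (f : PartialBool n) : ℕ :=
  sInf {p : ℕ | ∃ (s : Fin p → Cube n) (l : Cube p → ZMod 2), ParityComputes s l f}

/-- The partial function `f_k` on `n` bits (meant for `k < n`): `0` on inputs of Hamming weight
at most `k`, `1` on the all-ones input, undefined otherwise. -/
def thresholdFun (n k : ℕ) : PartialBool n := fun x =>
  if hammingNorm x ≤ k then some 0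
  else if hammingNorm x = n then some 1
  else none

/-- Sending the whole input is a protocol, so the set defining `oneWayCC` is nonempty. -/
theorem exists_oneWay {n : ℕ} (F : Cube n → Cube n → Option (ZMod 2)) :
    ∃ (t : ℕ) (h : Cube n → Cube t) (φ : Cube t → Cube n → ZMod 2), OneWayComputes h φ F := by
  refine ⟨n, id, fun x y => (F x y).getD 0, ?_⟩
  intro x y b hb
  simp [hb]

/-- Querying every bit is a protocol, so the set defining `nadt` is nonempty. -/
theorem exists_parity {n : ℕ} (f : PartialBool n) :
    ∃ (p : ℕ) (s : Fin p → Cube n) (l : Cube p → ZMod 2), ParityComputes s l f := by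
  refine ⟨n, fun i => Pi.single i 1, fun x => (f x).getD 0, ?_⟩
  intro x b hb
  simp [hb]

end XorComm

namespace XorComm

/-! Upper bound: identify 32 coordinates with `𝔽₂⁵`. Alice sends the parity of her restricted word
(1 bit) and, after flipping one bit if needed to make the weight even, a nearby affine function (6
bits). Even words lie within 12 of such a function, so equal messages mean distance at most 24
(`exists_coloring`). If `x + y` has weight at most 7 and `z + y` is all ones, then `x` and `z`
differ in at least 25 of the 32 places, so their messages differ. Parity queries: the images of the
coordinate vectors under `p` queries lie in `𝔽₂ᵖ`, so the image of the all-ones input is also that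
of an input of weight at most `p`. Hence `k` queries fail, while reading `k + 1` coordinates
suffices. -/

/-- The nontrivial character of `𝔽₂`, with values in `ℤ`. -/
def sign (z : ZMod 2) : ℤ := if z = 0 then 1 else -1

theorem sign_add : ∀ y z : ZMod 2, sign (y + z) = sign y * sign z := by
  decide

theorem sign_eq_one_sub : ∀ z : ZMod 2, sign z = 1 - 2 * (if z ≠ 0 then 1 else 0) := by
  decide

theorem eq_one_of_ne_zero : ∀ z : ZMod 2, z ≠ 0 → z = 1 := by
  decide

section Walsh

variable {ι : Type*} [Fintype ι]

theorem sum_sign (y : ι → ZMod 2) :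
    ∑ v, sign (y v) = Fintype.card ι - 2 * hammingNorm y := by
  simp only [sign_eq_one_sub, Finset.sum_sub_distrib, ← Finset.mul_sum, hammingNorm,
    Finset.sum_boole]
  simp

theorem natCast_hammingNorm (y : ι → ZMod 2) : (hammingNorm y : ZMod 2) = ∑ v, y v := by
  rw [hammingNorm, Finset.card_filter, Nat.cast_sum]
  refine Finset.sum_congr rfl fun v _ => ?_
  by_cases h : y v = 0
  · simp [h]
  · simp [eq_one_of_ne_zero _ h]

theorem hammingNorm_add_one (y : ι → ZMod 2) :
    hammingNorm y + hammingNorm (fun v => y v + 1) = Fintype.card ι := by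
  have h : ∀ z : ZMod 2, z + 1 ≠ 0 ↔ ¬ z ≠ 0 := by decide
  simp only [hammingNorm, h]
  rw [Finset.card_filter_add_card_filter_not, Finset.card_univ]

theorem hammingNorm_add_le (x y : ι → ZMod 2) :
    hammingNorm (x + y) ≤ hammingNorm x + hammingNorm y := by
  classical
  refine (Finset.card_le_card fun i hi => ?_).trans (Finset.card_union_le _ _)
  simp only [Finset.mem_union, Finset.mem_filter, Finset.mem_univ, true_and, Pi.add_apply]
    at hi ⊢
  by_contra! h
  exact hi (by rw [h.1, h.2, add_zero])

end Walsh

/-- Shifting `a` by a unit vector at a coordinate where `u` is nonzero flips every sign. -/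
theorem sum_sign_dotProduct {m : ℕ} {u : Cube m} (hu : u ≠ 0) :
    ∑ a : Cube m, sign (a ⬝ᵥ u) = 0 := by
  obtain ⟨j, hj⟩ := Function.ne_iff.mp hu
  have h : ∑ a : Cube m, sign (a ⬝ᵥ u) = ∑ a : Cube m, - sign (a ⬝ᵥ u) := by
    refine (Equiv.sum_comp (Equiv.addRight (Pi.single j 1 : Cube m)) _).symm.trans ?_
    refine Finset.sum_congr rfl fun a _ => ?_
    simp [add_dotProduct, sign_add, eq_one_of_ne_zero _ hj, show sign 1 = -1 from rfl]
  rw [Finset.sum_neg_distrib] at h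
  linarith

/-- Parseval's identity for the Walsh transform. -/
theorem sum_walsh_sq {m : ℕ} (x : Cube m → ZMod 2) :
    ∑ a : Cube m, (∑ v, sign (x v + a ⬝ᵥ v)) ^ 2 = 2 ^ m * 2 ^ m := by
  have key : ∀ v w : Cube m, ∑ a : Cube m, sign (x v + a ⬝ᵥ v) * sign (x w + a ⬝ᵥ w)
      = if v = w then 2 ^ m else 0 := by
    intro v w
    have h : ∀ a : Cube m, sign (x v + a ⬝ᵥ v) * sign (x w + a ⬝ᵥ w)
        = sign (x v + x w) * sign (a ⬝ᵥ (v + w)) := by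
      intro a
      simp only [sign_add, dotProduct_add]
      ring
    simp only [h, ← Finset.mul_sum]
    split_ifs with hvw
    · subst hvw
      simp [CharTwo.add_self_eq_zero, sign]
    · rw [sum_sign_dotProduct, mul_zero]
      refine fun h => hvw (funext fun i => CharTwo.add_eq_zero.mp (congrFun h i))
  simp only [sq, Finset.sum_mul_sum]
  rw [Finset.sum_comm]
  simp_rw [Finset.sum_comm (s := (Finset.univ : Finset (Cube m))) (t := Finset.univ)
    (f := fun a w => sign (x _ + a ⬝ᵥ _) * sign (x w + a ⬝ᵥ w)), key]
  simp

/-- Every word of even weight and length `32` is within distance `12` of an affine function,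
that is, of the first-order Reed-Muller code. -/
theorem exists_affine_near (x : Cube 5 → ZMod 2) (hx : ∑ v, x v = 0) :
    ∃ (a : Cube 5) (b : ZMod 2), hammingNorm (fun v => x v + (a ⬝ᵥ v + b)) ≤ 12 := by
  -- By Parseval the 32 squared Walsh coefficients sum to 32², so one is at least their average, 32.
  obtain ⟨a, ha⟩ : ∃ a : Cube 5, 32 ≤ (∑ v, sign (x v + a ⬝ᵥ v)) ^ 2 := by
    by_contra! hlt
    have h := Finset.sum_lt_sum_of_nonempty (Finset.univ_nonempty (α := Cube 5))
      fun a _ => hlt a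
    rw [sum_walsh_sq] at h
    simp at h
  -- Linear functions on `𝔽₂⁵` have even weight, so adding one preserves parity.
  have heven : Even (hammingNorm fun v => x v + a ⬝ᵥ v) := by
    rw [← ZMod.natCast_eq_zero_iff_even, natCast_hammingNorm, Finset.sum_add_distrib, hx,
      zero_add, ← dotProduct_sum]
    have : ∑ v : Cube 5, v = 0 := by
      decide +kernel
    rw [this, dotProduct_zero]
  rw [sum_sign] at ha
  have hcard : Fintype.card (Cube 5) = 32 := by simp
  have hadd := hammingNorm_add_one fun v => x v + a ⬝ᵥ v
  rw [hcard] at ha hadd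
  obtain ⟨k, hk⟩ := heven
  rw [hk] at ha hadd
  push_cast at ha
  by_cases hk6 : k ≤ 6
  · refine ⟨a, 0, ?_⟩
    simp only [add_zero]
    lia
  · refine ⟨a, 1, ?_⟩
    simp only [← add_assoc]
    -- The coefficient is `32 - 4 * k`, a multiple of 4 with square at least 32, hence of absolute
    -- value at least 8. This excludes `k = 7, 8, 9`; for `k ≥ 10` the complement is close.
    have : 10 ≤ k := by
      by_contra! h
      interval_cases k <;> norm_num at ha
    lia

/-- `128` classes, each of diameter at most `24`, partition the words of length `32`. -/
theorem exists_coloring : ∃ c : (Cube 5 → ZMod 2) → Cube 7,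
    ∀ x y, c x = c y → hammingNorm (fun v => x v + y v) ≤ 24 := by
  let r : (Cube 5 → ZMod 2) → Cube 5 → ZMod 2 := fun x => x + Pi.single 0 (∑ v, x v)
  have hr : ∀ x, ∑ v, r x v = 0 := by
    intro x
    simp [r, Finset.sum_add_distrib, CharTwo.add_self_eq_zero]
  choose a b hab using fun x => exists_affine_near (r x) (hr x)
  refine ⟨fun x => Fin.cons (∑ v, x v) (Fin.cons (b x) (a x)), fun x y h => ?_⟩
  obtain ⟨hp, h⟩ := Fin.cons_inj.mp h
  obtain ⟨hb, ha⟩ := Fin.cons_inj.mp h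
  -- Equal messages mean equal parity corrections and equal affine functions, which cancel in
  -- characteristic 2.
  have hsum : (fun v => x v + y v) =
      (fun v => r x v + (a x ⬝ᵥ v + b x)) + fun v => r y v + (a y ⬝ᵥ v + b y) := by
    funext v
    simp only [r, Pi.add_apply, hp, hb, ha]
    have : ∀ p q s t : ZMod 2, p + q = p + s + t + (q + s + t) := by decide
    rw [this, add_assoc _ _ (a y ⬝ᵥ v + b y), add_assoc]
  rw [hsum]
  refine (hammingNorm_add_le _ _).trans ?_
  have := hab x
  have := hab y
  lia

theorem eq_one_of_hammingNorm_eq {n : ℕ} {x : Cube n} (h : hammingNorm x = n) (i : Fin n) :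
    x i = 1 := by
  apply eq_one_of_ne_zero
  have : Finset.univ.filter (fun i => x i ≠ 0) = Finset.univ := by
    rw [← Finset.card_eq_iff_eq_univ, Fintype.card_fin]
    exact h
  simpa using Finset.ext_iff.mp this i

theorem thresholdFun_eq_zero {n k : ℕ} {x : Cube n} (h : thresholdFun n k x = some 0) :
    hammingNorm x ≤ k := by
  unfold thresholdFun at h
  split_ifs at h with h1 h2
  · exact h1
  · simp at h

theorem thresholdFun_eq_one {n k : ℕ} {x : Cube n} (h : thresholdFun n k x = some 1) :
    hammingNorm x = n := by
  unfold thresholdFun at h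
  split_ifs at h with h1 h2
  · simp at h
  · exact h2

theorem oneWayCC_thresholdFun_le (n : ℕ) (hn : 32 ≤ n) :
    oneWayCC (xorFun (thresholdFun n 7)) ≤ 7 := by
  classical
  obtain ⟨e⟩ : Nonempty (Cube 5 ↪ Fin n) := by
    apply Function.Embedding.nonempty_of_card_le
    simpa using hn
  obtain ⟨c, hc⟩ := exists_coloring
  -- Bob answers 1 exactly when some input with the received message is the complement of `y`.
  refine Nat.sInf_le ⟨fun x => c (x ∘ e), fun m y =>
    if ∃ x : Cube n, c (x ∘ e) = m ∧ thresholdFun n 7 (x + y) = some 1 then 1 else 0, ?_⟩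
  intro x y b hb
  simp only [xorFun] at hb
  by_cases hb1 : b = 1
  · subst hb1
    exact if_pos ⟨x, rfl, hb⟩
  have hb0 : b = 0 := by
    by_contra h
    exact hb1 (eq_one_of_ne_zero _ h)
  subst hb0
  refine if_neg ?_
  rintro ⟨z, hz, hzy⟩
  have h7 := thresholdFun_eq_zero hb
  have hone := eq_one_of_hammingNorm_eq (thresholdFun_eq_one hzy)
  have h24 := hc _ _ hz
  have hsplit := hammingNorm_add_one fun v => (z ∘ e) v + (x ∘ e) v
  -- Where `z` and `x` agree, `x + y` equals `z + y`, which is 1. There are at least 32 - 24 = 8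
  -- such places, against weight at most 7.
  have hle : hammingNorm (fun v => (z ∘ e) v + (x ∘ e) v + 1) ≤ hammingNorm (x + y) := by
    refine Finset.card_le_card_of_injOn e (fun v hv => ?_) e.injective.injOn
    have h1 := hone (e v)
    have : ∀ p q s : ZMod 2, p + s = 1 → p + q + 1 ≠ 0 → q + s ≠ 0 := by decide
    simp only [Finset.coe_filter, Finset.mem_univ, true_and, Set.mem_ofPred_eq] at hv ⊢
    exact this _ _ _ h1 hv
  have hcard : Fintype.card (Cube 5) = 32 := by simp
  lia

/-- A sum of vectors of `𝔽₂ᵖ` is the sum of at most `p` of them. -/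
theorem exists_hammingNorm_le_dotProduct_eq {n p : ℕ} (s : Fin p → Cube n) (y : Cube n) :
    ∃ x : Cube n, hammingNorm x ≤ p ∧ ∀ i, s i ⬝ᵥ x = s i ⬝ᵥ y := by
  classical
  let col : Fin n → Cube p := fun j i => s i j
  -- A maximal independent set of columns has at most `p` members and spans the image of `y`; its
  -- coefficients give `x`.
  obtain ⟨κ, a, ha, hspan, hli⟩ := exists_linearIndependent' (ZMod 2) col
  have : Finite κ := Finite.of_injective a ha
  have := Fintype.ofFinite κ
  have hmem : ∑ j, y j • col j ∈ Submodule.span (ZMod 2) (Set.range (col ∘ a)) := by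
    rw [hspan]
    exact Submodule.sum_mem _ fun j _ => Submodule.smul_mem _ _ (Submodule.subset_span ⟨j, rfl⟩)
  obtain ⟨w, hw⟩ := (Submodule.mem_span_range_iff_exists_fun (ZMod 2)).mp hmem
  refine ⟨∑ k, Pi.single (a k) (w k), ?_, fun i => ?_⟩
  · have hcard : Fintype.card κ ≤ p := by
      simpa using hli.fintype_card_le_finrank
    refine le_trans ?_ hcard
    refine (Finset.card_le_card (t := Finset.univ.image a) fun j hj => ?_).trans
      Finset.card_image_le
    simp only [Finset.mem_filter, Finset.mem_univ, true_and, Finset.sum_apply] at hj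
    obtain ⟨k, -, hk⟩ := Finset.exists_ne_zero_of_sum_ne_zero hj
    refine Finset.mem_image.mpr ⟨k, Finset.mem_univ _, ?_⟩
    by_contra hne
    exact hk (Pi.single_eq_of_ne (Ne.symm hne) _)
  · have h := congrFun hw i
    simp only [Finset.sum_apply, Pi.smul_apply, Function.comp_apply, smul_eq_mul, col] at h
    rw [dotProduct_sum]
    simp only [dotProduct_single]
    rw [dotProduct]
    simpa only [mul_comm] using h

theorem le_of_parityComputes {n k p : ℕ} (hk : k < n) {s : Fin p → Cube n} {l : Cube p → ZMod 2}
    (h : ParityComputes s l (thresholdFun n k)) : k + 1 ≤ p := by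
  by_contra! hp
  obtain ⟨x, hx, hsx⟩ := exists_hammingNorm_le_dotProduct_eq s 1
  have h0 := h x 0 (by rw [thresholdFun, if_pos (by lia)])
  have hone : hammingNorm (1 : Cube n) = n := by simp [hammingNorm]
  have h1 := h 1 1 (by rw [thresholdFun, if_neg (by lia), if_pos hone])
  simp only [hsx] at h0
  exact zero_ne_one (h0.symm.trans h1)

theorem parityComputes_coordinates {n k : ℕ} (hk : k + 1 ≤ n) :
    ParityComputes (fun i : Fin (k + 1) => Pi.single (Fin.castLE hk i) 1)
      (fun z => if z = 1 then 1 else 0) (thresholdFun n k) := by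
  intro x b hb
  simp only [single_dotProduct, one_mul]
  by_cases hb1 : b = 1
  · subst hb1
    exact if_pos (funext fun i => eq_one_of_hammingNorm_eq (thresholdFun_eq_one hb) _)
  have hb0 : b = 0 := by
    by_contra h
    exact hb1 (eq_one_of_ne_zero _ h)
  subst hb0
  refine if_neg fun h => ?_
  have hle : (Finset.univ : Finset (Fin (k + 1))).card ≤ hammingNorm x := by
    refine Finset.card_le_card_of_injOn (Fin.castLE hk) (fun i _ => ?_)
      (Fin.castLE_injective hk).injOn
    have hi : x (Fin.castLE hk i) = 1 := congrFun h i
    simp [hi]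
  rw [Finset.card_univ, Fintype.card_fin] at hle
  have := thresholdFun_eq_zero hb
  lia

theorem nadt_thresholdFun {n k : ℕ} (hk : k < n) : nadt (thresholdFun n k) = k + 1 := by
  refine le_antisymm (Nat.sInf_le ⟨_, _, parityComputes_coordinates hk⟩) ?_
  refine le_csInf (exists_parity _) ?_
  rintro p ⟨s, l, h⟩
  exact le_of_parityComputes hk h

end XorComm

theorem mainTheorem10 (n : ℕ) (hn : 32 ≤ n) :
    XorComm.oneWayCC (XorComm.xorFun (XorComm.thresholdFun n 7)) ≤ 7 ∧
      XorComm.nadt (XorComm.thresholdFun n 7) = 8 :=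
  ⟨XorComm.oneWayCC_thresholdFun_le n hn, XorComm.nadt_thresholdFun (by lia)⟩
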